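/- All graphs are finite. For a DAG $G=(V,E)$ and $v\in V$, let $\mathrm{Des}(v)$ be the set of vertices $w\neq v$ reachable from $v$ by a directed path, $\mathrm{Des}[v]=\mathrm{Des}(v)\cup\{v\}$ and $A_v=V\setminus \mathrm{Des}[v]$. $G$ is \emph{moral} if it has no v-structure, i.e. no distinct $u,v,w$ with $u\to v\leftarrow w$ and $u,w$ non-adjacent. A set $K\subseteq V$ is a \emph{$1/2$-clique separator} if its vertices are pairwise adjacent and $V\setminus K$ is the disjoint union of two (possibly empty) sets $A,B$ with $|A|,|B|\le |V|/2$ and no edge between $A$ and $B$. Two DAGs on $V$ are \emph{Markov equivalent} if exactly the same positive distributions factorize according to them. For a set $\mathcal I$ of subsets of $V$, let $[G]_{\mathcal I}$ be the set of DAGs Markov equivalent to $G$ in which, for every $I\in\mathcal I$, all arcs between $I$ and $V\setminus I$ are oriented as in $G$. The \emph{$\mathcal I$-essential graph} of $G$ has an arc $a\to b$ if $a\to b$ in every member of $[G]_{\mathcal I}$, and an undirected edge $a\sim b$ if some two members of $[G]_{\mathcal I}$ orient it in opposite ways. $\mathcal I$ is a \emph{$1/2$-Meek separator} of $G$ if every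 connected component of the undirected part of its $\mathcal I$-essential graph has at most $|V|/2$ vertices (isolated vertices count as components). \textbf{Lemma.} Let $G=(V,E)$ be a moral DAG with $|V|\ge 2$ and connected skeleton, and let $K$ be a $1/2$-clique separator of $G$. Then there exists $u\in K$ such that $$|A_u|\le |V|/2\quad\text{and}\quad |A_v|>|V|/2\ \text{ for all } v\in \mathrm{Des}(u)\cap K. \qquad (*)$$ Furthermore, every $u\in K$ satisfying $(*)$ satisfies one of the following: 1) $u$ is a sink of the induced subgraph $G[K]$; or 2) there is a vertex $x\in \mathrm{Des}(u)\cap K$ with $\big((V\setminus \mathrm{Des}[x])\cap \mathrm{Des}(u)\big)\cap K=\varnothing$ (that is, $x$ is the next vertex of $K$ after $u$). In case 1), $\{\{u\}\}$ is a $1/2$-Meek separator of $G$; in case 2), $\{\{u\},\{x\}\}$ is a $1/2$-Meek separator of $G$ for every such $x$. -/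

import Mathlib

namespace CausalGraph

variable {V : Type*}

/-! ### Directed acyclic graphs -/

/-- A digraph is a DAG if no vertex can be reached from itself by a nonempty directed path. -/
def IsDAG (G : Digraph V) : Prop :=
  ∀ v, ¬ Relation.TransGen G.Adj v v

/-- The skeleton: all edges are made undirected. -/
def skeleton (G : Digraph V) : SimpleGraph V :=
  SimpleGraph.fromRel G.Adj

/-- `u → v ← w` with `u` and `w` distinct and not adjacent. -/
def IsVStructure (G : Digraph V) (u v w : V) : Prop :=
  G.Adj u v ∧ G.Adj w v ∧ u ≠ w ∧ ¬ (skeleton G).Adj u w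

/-- A moral DAG is a DAG without v-structures. -/
def IsMoralDAG (G : Digraph V) : Prop :=
  IsDAG G ∧ ∀ u v w, ¬ IsVStructure G u v w

/-- The parents of `v`. -/
def parents (G : Digraph V) (v : V) : Set V :=
  {w | G.Adj w v}

/-- The proper descendants `Des(v)` of `v`. -/
def des (G : Digraph V) (v : V) : Set V :=
  {w | Relation.TransGen G.Adj v w}

/-- `Des[v] = Des(v) ∪ {v}`. -/
def desClosed (G : Digraph V) (v : V) : Set V :=
  insert v (des G v)

/-- `u` is a sink of the induced subgraph `G[K]`: it belongs to `K` and has no child in `K`. -/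
def IsSinkOf (G : Digraph V) (K : Set V) (u : V) : Prop :=
  u ∈ K ∧ ∀ w ∈ K, ¬ G.Adj u w

/-! ### Separators -/

/-- `C` is an `α`-separator: the other vertices split into two (possibly empty) parts `A`, `B` of
size at most `α |V|` with no edge between `A` and `B`. -/
def IsSeparator (α : ℝ) (S : SimpleGraph V) (C : Set V) : Prop :=
  ∃ A B : Set V, A ∪ B ∪ C = Set.univ ∧ Disjoint A B ∧ Disjoint A C ∧ Disjoint B C ∧
    (∀ a ∈ A, ∀ b ∈ B, ¬ S.Adj a b) ∧
    (A.ncard : ℝ) ≤ α * Nat.card V ∧ (B.ncard : ℝ) ≤ α * Nat.card V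

/-- An `α`-clique separator is an `α`-separator that is a clique. -/
def IsCliqueSeparator (α : ℝ) (S : SimpleGraph V) (C : Set V) : Prop :=
  IsSeparator α S C ∧ S.IsClique C

/-! ### Markov equivalence -/

section Markov

variable [Fintype V]

open Classical in
/-- A positive joint distribution (probability mass function) of random variables indexed by `V`,
the variable at `v` taking values in the finite set `Ω v`. -/
structure PositiveDistribution (Ω : V → Type) [∀ v, Fintype (Ω v)] where
  prob : (∀ v, Ω v) → ℝ
  pos : ∀ x, 0 < prob x
  sum_eq_one : ∑ x, prob x = 1

variable {Ω : V → Type} [∀ v, Fintype (Ω v)]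

open Classical in
/-- The marginal probability that the variables in `S` take the values prescribed by `x`. -/
noncomputable def PositiveDistribution.marginal (P : PositiveDistribution Ω) (S : Set V)
    (x : ∀ v, Ω v) : ℝ :=
  ∑ y : ∀ v, Ω v, if ∀ v ∈ S, y v = x v then P.prob y else 0

/-- The conditional probability `P(x_v | x_S)`; the denominator is positive. -/
noncomputable def PositiveDistribution.cond (P : PositiveDistribution Ω) (v : V) (S : Set V)
    (x : ∀ v, Ω v) : ℝ :=
  P.marginal (insert v S) x / P.marginal S x

/-- `P` factorizes according to `G`: `P(x) = ∏_v P(x_v | x_{Pa(v)})` for all `x`. -/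
def PositiveDistribution.Factorizes (P : PositiveDistribution Ω) (G : Digraph V) : Prop :=
  ∀ x, P.prob x = ∏ v, P.cond v (parents G v) x

/-- Two DAGs on `V` are Markov equivalent if the same positive distributions factorize according
to them, whatever the (finite) ranges of the variables. -/
def MarkovEquivalent (G H : Digraph V) : Prop :=
  ∀ (Ω : V → Type) [∀ v, Fintype (Ω v)] (P : PositiveDistribution Ω),
    P.Factorizes G ↔ P.Factorizes H

/-! ### Interventional essential graphs -/

/-- The pair `a`, `b` is cut by `I` and its complement. -/
def IsCut (I : Set V) (a b : V) : Prop :=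
  (a ∈ I ∧ b ∉ I) ∨ (a ∉ I ∧ b ∈ I)

/-- The DAGs in the Markov equivalence class of `G` in which, for every `I` in the intervention
set `𝓘`, the arcs cut by `I` and its complement are oriented as in `G`. -/
def interventionalClass (G : Digraph V) (𝓘 : Set (Set V)) : Set (Digraph V) :=
  {H | IsDAG H ∧ MarkovEquivalent G H ∧
    ∀ I ∈ 𝓘, ∀ a b, IsCut I a b → (H.Adj a b ↔ G.Adj a b)}

/-- A partially oriented graph: oriented arcs together with undirected edges. -/
structure PartiallyOrientedGraph (V : Type*) where
  arc : V → V → Prop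
  undirected : SimpleGraph V

/-- The graph representing a class of DAGs: `a → b` is an arc if it is an arc of every member,
and `a`, `b` are joined by an undirected edge if some two members orient it in opposite ways. -/
def representingGraph (M : Set (Digraph V)) (hM : ∀ H ∈ M, IsDAG H) :
    PartiallyOrientedGraph V where
  arc a b := ∀ H ∈ M, H.Adj a b
  undirected :=
    { Adj := fun a b => ∃ H₁ ∈ M, ∃ H₂ ∈ M, H₁.Adj a b ∧ H₂.Adj b a
      symm := ⟨fun _ _ ⟨H₁, h₁, H₂, h₂, hab, hba⟩ => ⟨H₂, h₂, H₁, h₁, hba, hab⟩⟩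
      loopless := ⟨fun a ⟨H₁, h₁, _, _, haa, _⟩ => hM H₁ h₁ a (Relation.TransGen.single haa)⟩ }

/-- The `𝓘`-essential graph of `G`. -/
def essentialGraph (G : Digraph V) (𝓘 : Set (Set V)) : PartiallyOrientedGraph V :=
  representingGraph (interventionalClass G 𝓘) (fun _ h => h.1)

/-- `𝓘` is an `α`-Meek separator of `G`: every chain component of the `𝓘`-essential graph (every
connected component of its undirected part) has at most `α |V|` vertices. -/
def IsMeekSeparator (α : ℝ) (G : Digraph V) (𝓘 : Set (Set V)) : Prop :=
  ∀ C : (essentialGraph G 𝓘).undirected.ConnectedComponent,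
    (C.supp.ncard : ℝ) ≤ α * Nat.card V

end Markov

/-- The constraints on the vertex `u` of `K`: `|V ∖ Des[u]| ≤ |V| / 2`, and
`|V ∖ Des[v]| > |V| / 2` for all `v ∈ Des(u) ∩ K`. -/
def SatisfiesConstraints (G : Digraph V) (K : Set V) (u : V) : Prop :=
  ((desClosed G u)ᶜ.ncard : ℝ) ≤ (Nat.card V : ℝ) / 2 ∧
    ∀ v ∈ des G u ∩ K, (Nat.card V : ℝ) / 2 < ((desClosed G v)ᶜ.ncard : ℝ)

/-- `x` is the next vertex of `K` after `u`: `x ∈ Des(u) ∩ K` and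
`((V ∖ Des[x]) ∩ Des(u)) ∩ K = ∅`. -/
def IsNext (G : Digraph V) (K : Set V) (u x : V) : Prop :=
  x ∈ des G u ∩ K ∧ ((desClosed G x)ᶜ ∩ des G u) ∩ K = ∅

end CausalGraph

namespace CausalGraph

/-! Uniform bits with a biased parity on `T` factorize over a DAG exactly when some vertex of `T`
has the rest of `T` as parents. Pairs and triples `T` then show that Markov equivalence preserves
skeleton and v-structures, so every member of the class is moral with the skeleton of `G`.
Intervening on `{u}` fixes the arcs at `u`. Absence of v-structures propagates orientations along
shortest paths from `u`, so `des G u` is the same in all members, and a chain component lies in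
`A_u`, `{u}` or `Des(u)` (`supp_trichotomy`). A component missing `K` is small because `K` separates
(`IsSeparator.ncard_le`). In case 1, `Des(u)` misses `K`; in case 2, so does `Des(u) ∩ A_x`, while
`Des(x)` is small because `A_x` is large. For existence, the clique `K` is totally ordered by
descent. The non-descendants of its first vertex miss `K` and are connected through common
ancestors, hence few; the last vertex of `K` with few non-descendants is the required `u`. -/

lemma skeleton_adj {V : Type*} {G : Digraph V} {a b : V} :
    (skeleton G).Adj a b ↔ a ≠ b ∧ (G.Adj a b ∨ G.Adj b a) :=
  SimpleGraph.fromRel_adj _ _ _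

/-! ### Parity distributions -/

section Parity

variable {V : Type*} [Fintype V]

/-- The sign `±1` of a bit. -/
def bitSign (b : Bool) : ℝ := if b then 1 else -1

open Classical in
/-- The character `x ↦ ∏_{t ∈ T} ± 1` of the cube. -/
noncomputable def parityChar (T : Set V) (x : V → Bool) : ℝ :=
  ∏ v, if v ∈ T then bitSign (x v) else 1

lemma parityChar_eq_or (T : Set V) (x : V → Bool) :
    parityChar T x = 1 ∨ parityChar T x = -1 := by
  classical
  unfold parityChar
  refine Finset.prod_induction _ (fun r : ℝ => r = 1 ∨ r = -1) ?_ (Or.inl rfl) ?_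
  · rintro a b (rfl | rfl) (rfl | rfl) <;> norm_num
  · intro v _
    unfold bitSign
    split_ifs <;> simp

-- The agreement indicator is a product over coordinates, so the sum distributes over the product.
open Classical in
lemma sum_agree_prod (S : Set V) (x : V → Bool) (f : V → Bool → ℝ) :
    (∑ y : V → Bool, if ∀ v ∈ S, y v = x v then ∏ v, f v (y v) else 0) =
      ∏ v, if v ∈ S then f v (x v) else f v true + f v false := by
  have h1 : ∀ y : V → Bool, (if ∀ v ∈ S, y v = x v then ∏ v, f v (y v) else 0) =
      ∏ v, if v ∈ S ∧ y v ≠ x v then 0 else f v (y v) := by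
    intro y
    split_ifs with h
    · refine Finset.prod_congr rfl fun v _ => ?_
      rw [if_neg]
      rintro ⟨h1, h2⟩
      exact h2 (h v h1)
    · push Not at h
      obtain ⟨v, hv, hne⟩ := h
      symm
      exact Finset.prod_eq_zero (Finset.mem_univ v) (if_pos ⟨hv, hne⟩)
  rw [Finset.sum_congr rfl fun y _ => h1 y]
  have h2 := Finset.prod_univ_sum (fun _ : V => (Finset.univ : Finset Bool))
    (fun v b => if v ∈ S ∧ b ≠ x v then 0 else f v b)
  rw [Fintype.piFinset_univ] at h2
  rw [← h2]
  refine Finset.prod_congr rfl fun v _ => ?_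
  rw [Fintype.sum_bool]
  by_cases hv : v ∈ S
  · cases hx : x v <;> simp [hv]
  · simp [hv]

open Classical in
/-- The number of bit vectors with prescribed values on `S`. -/
noncomputable def freeCount (S : Set V) : ℝ := ∏ v, if v ∈ S then 1 else 2

lemma freeCount_pos (S : Set V) : 0 < freeCount S := by
  classical
  exact Finset.prod_pos fun v _ => by split_ifs <;> norm_num

lemma freeCount_eq_two_mul_insert {S : Set V} {v : V} (hv : v ∉ S) :
    freeCount S = 2 * freeCount (insert v S) := by
  classical
  unfold freeCount
  have h1 := Finset.mul_prod_erase Finset.univ (fun w => if w ∈ S then (1 : ℝ) else 2)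
    (Finset.mem_univ v)
  have h2 := Finset.mul_prod_erase Finset.univ (fun w => if w ∈ insert v S then (1 : ℝ) else 2)
    (Finset.mem_univ v)
  have : ∀ w ∈ Finset.univ.erase v, (if w ∈ S then (1 : ℝ) else 2) =
      if w ∈ insert v S then 1 else 2 := by
    intro w hw
    simp [Finset.ne_of_mem_erase hw]
  rw [Finset.prod_congr rfl this] at h1
  rw [if_neg hv] at h1
  rw [if_pos (Set.mem_insert v S), one_mul] at h2
  rw [← h1, h2]
  congr!

open Classical in
lemma sum_agree_one (S : Set V) (x : V → Bool) :
    (∑ y : V → Bool, if ∀ v ∈ S, y v = x v then (1 : ℝ) else 0) = freeCount S := by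
  have := sum_agree_prod S x (fun _ _ => 1)
  simp only [Finset.prod_const_one] at this
  rw [this, freeCount]
  norm_num

-- A free bit in `T` contributes the factor `1 + (-1) = 0`.
open Classical in
lemma sum_agree_parityChar (S T : Set V) (x : V → Bool) :
    (∑ y : V → Bool, if ∀ v ∈ S, y v = x v then parityChar T y else 0) =
      if T ⊆ S then freeCount S * parityChar T x else 0 := by
  have := sum_agree_prod S x (fun v b => if v ∈ T then bitSign b else 1)
  unfold parityChar
  rw [this]
  split_ifs with h
  · rw [freeCount, ← Finset.prod_mul_distrib]
    refine Finset.prod_congr rfl fun v _ => ?_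
    by_cases hS : v ∈ S
    · simp [hS]
    · have hT : v ∉ T := fun hT => hS (h hT)
      simp [hS, hT]
      norm_num
  · obtain ⟨v, hT, hS⟩ := Set.not_subset.1 h
    refine Finset.prod_eq_zero (Finset.mem_univ v) ?_
    simp [hS, hT, bitSign]

/-- The positive distribution on bit vectors whose only correlation is a bias of the parity of the
bits in the nonempty set `T`. -/
noncomputable def parityDistribution (T : Set V) (hT : T.Nonempty) :
    PositiveDistribution (fun _ : V => Bool) where
  -- Halving the character keeps `1 ± 1/2` positive; the denominator is `2 ^ |V|`.
  prob x := (1 + parityChar T x / 2) / freeCount (∅ : Set V)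
  pos x := by
    have := freeCount_pos (∅ : Set V)
    rcases parityChar_eq_or T x with h | h <;> rw [h] <;> apply div_pos _ this <;> norm_num
  sum_eq_one := by
    classical
    have h0 := (freeCount_pos (∅ : Set V)).ne'
    have h1 := sum_agree_one (∅ : Set V) (fun _ => true)
    have h2 := sum_agree_parityChar (∅ : Set V) T (fun _ => true)
    have hne : ¬ T ⊆ ∅ := fun h => hT.ne_empty (Set.subset_empty_iff.1 h)
    simp only [Set.mem_empty_iff_false, false_imp_iff, implies_true, if_true, if_neg hne] at h1 h2
    rw [← Finset.sum_div, Finset.sum_add_distrib, ← Finset.sum_div, h2]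
    rw [div_eq_one_iff_eq h0, zero_div, add_zero]
    convert h1

open Classical in
lemma marginal_parityDistribution (T : Set V) (hT : T.Nonempty) (S : Set V) (x : V → Bool) :
    (parityDistribution T hT).marginal S x =
      freeCount S * (1 + if T ⊆ S then parityChar T x / 2 else 0) / freeCount (∅ : Set V) := by
  have h : (parityDistribution T hT).marginal S x =
      ∑ y : V → Bool, ((if ∀ v ∈ S, y v = x v then 1 else 0) +
        (if ∀ v ∈ S, y v = x v then parityChar T y else 0) / 2) / freeCount (∅ : Set V) := by
    refine Finset.sum_congr (by congr!) fun y _ => ?_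
    split_ifs
    · rfl
    · simp
  rw [h, ← Finset.sum_div, Finset.sum_add_distrib,
    ← Finset.sum_div, sum_agree_one, sum_agree_parityChar]
  split_ifs <;> ring

-- The bias survives in the quotient only if adding `v` to `S` completes `T`; otherwise it is in
-- both marginals or in neither.
open Classical in
lemma cond_parityDistribution (T : Set V) (hT : T.Nonempty) {S : Set V} {v : V} (hv : v ∉ S)
    (x : V → Bool) :
    (parityDistribution T hT).cond v S x =
      (if v ∈ T ∧ T ⊆ insert v S then 1 + parityChar T x / 2 else 1) / 2 := by
  unfold PositiveDistribution.cond
  rw [marginal_parityDistribution, marginal_parityDistribution, freeCount_eq_two_mul_insert hv]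
  have h0 := (freeCount_pos (∅ : Set V)).ne'
  have h1 := (freeCount_pos (insert v S)).ne'
  have h2 : 1 + parityChar T x / 2 ≠ 0 := by
    rcases parityChar_eq_or T x with h | h <;> rw [h] <;> norm_num
  by_cases hvT : v ∈ T
  · have hTS : ¬ T ⊆ S := fun h => hv (h hvT)
    by_cases hTi : T ⊆ insert v S
    · rw [if_pos hTi, if_neg hTS, if_pos ⟨hvT, hTi⟩]
      field_simp
      ring
    · rw [if_neg hTi, if_neg hTS, if_neg (fun h : v ∈ T ∧ _ => hTi h.2)]
      field_simp
  · have hiff : T ⊆ insert v S ↔ T ⊆ S := Set.subset_insert_iff_of_notMem hvT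
    by_cases hTS : T ⊆ S
    · rw [if_pos hTS, if_pos (hiff.2 hTS), if_neg (fun h : v ∈ T ∧ _ => hvT h.1)]
      generalize 1 + parityChar T x / 2 = q at h2 ⊢
      field_simp
    · rw [if_neg hTS, if_neg fun h => hTS (hiff.1 h), if_neg (fun h : v ∈ T ∧ _ => hvT h.1)]
      field_simp

lemma freeCount_empty : freeCount (∅ : Set V) = ∏ _v : V, (2 : ℝ) := by
  simp [freeCount]

/-- The parity distribution of `T` factorizes according to a DAG if and only if some vertex of `T`
has all other vertices of `T` as parents. -/
lemma factorizes_parityDistribution_iff {G : Digraph V} (hG : IsDAG G) {T : Set V}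
    (hT : T.Nontrivial) :
    (parityDistribution T hT.nonempty).Factorizes G ↔
      ∃ v ∈ T, ∀ t ∈ T, t ≠ v → G.Adj t v := by
  classical
  have hpar : ∀ v, v ∉ parents G v := fun v h => hG v (.single h)
  have hiff : ∀ v, (v ∈ T ∧ T ⊆ insert v (parents G v)) ↔
      (v ∈ T ∧ ∀ t ∈ T, t ≠ v → G.Adj t v) := by
    intro v
    refine and_congr_right fun _ => forall₂_congr fun t _ => ?_
    rw [Set.mem_insert_iff, or_iff_not_imp_left]
    rfl
  have hprod : ∀ x, ∏ v, (parityDistribution T hT.nonempty).cond v (parents G v) x =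
      (∏ v, if v ∈ T ∧ ∀ t ∈ T, t ≠ v → G.Adj t v then 1 + parityChar T x / 2 else 1) /
        freeCount (∅ : Set V) := by
    intro x
    rw [freeCount_empty, ← Finset.prod_div_distrib]
    refine Finset.prod_congr rfl fun v _ => ?_
    rw [cond_parityDistribution T hT.nonempty (hpar v)]
    simp only [hiff]
  have h0 := (freeCount_pos (∅ : Set V)).ne'
  constructor
  · intro h
    -- Without such a vertex the product is the uniform distribution, but the parity bias is nonzero
    -- at every point.
    by_contra hne
    have hx := h (fun _ => true)
    rw [hprod, Finset.prod_congr rfl fun v _ => if_neg fun hv => hne ⟨v, hv⟩,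
      Finset.prod_const_one] at hx
    change (1 + parityChar T _ / 2) / _ = _ at hx
    rw [div_left_inj' h0] at hx
    rcases parityChar_eq_or T (fun _ => true) with h | h <;> rw [h] at hx <;> norm_num at hx
  · rintro ⟨v, hvT, hv⟩ x
    rw [hprod, Finset.prod_eq_single v, if_pos ⟨hvT, hv⟩]
    · rfl
    · rintro w - hw
      -- Two such vertices would be parents of each other, so exactly one factor carries the bias.
      refine if_neg fun ⟨hwT, h⟩ => hG v ?_
      exact .tail (.single (h v hvT hw.symm)) (hv w hwT hw)
    · exact fun h => absurd (Finset.mem_univ v) h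

/-! ### Invariants of Markov equivalence -/

lemma MarkovEquivalent.symm {G H : Digraph V} (h : MarkovEquivalent G H) :
    MarkovEquivalent H G :=
  fun Ω _ P => (h Ω P).symm

lemma MarkovEquivalent.exists_common_child_iff {G H : Digraph V} (h : MarkovEquivalent G H)
    (hG : IsDAG G) (hH : IsDAG H) {T : Set V} (hT : T.Nontrivial) :
    (∃ v ∈ T, ∀ t ∈ T, t ≠ v → G.Adj t v) ↔ ∃ v ∈ T, ∀ t ∈ T, t ≠ v → H.Adj t v := by
  rw [← factorizes_parityDistribution_iff hG hT, ← factorizes_parityDistribution_iff hH hT]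
  exact h _ _

lemma MarkovEquivalent.adj_or_adj {G H : Digraph V} (h : MarkovEquivalent G H)
    (hG : IsDAG G) (hH : IsDAG H) {a b : V} (hab : a ≠ b) (hadj : G.Adj a b) :
    H.Adj a b ∨ H.Adj b a := by
  have hT : ({a, b} : Set V).Nontrivial := Set.nontrivial_pair hab
  obtain ⟨v, hv, hp⟩ := (h.exists_common_child_iff hG hH hT).1 ⟨b, by simp, by
    rintro t (rfl | rfl) ht
    · exact hadj
    · exact absurd rfl ht⟩
  rcases hv with rfl | rfl
  · exact .inr (hp b (by simp) hab.symm)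
  · exact .inl (hp a (by simp) hab)

/-- Markov equivalent DAGs have the same skeleton. -/
lemma MarkovEquivalent.skeleton_eq {G H : Digraph V} (h : MarkovEquivalent G H)
    (hG : IsDAG G) (hH : IsDAG H) : skeleton G = skeleton H := by
  ext a b
  rw [skeleton_adj, skeleton_adj]
  refine and_congr_right fun hab => ⟨?_, ?_⟩
  · rintro (hadj | hadj)
    · exact h.adj_or_adj hG hH hab hadj
    · exact (h.adj_or_adj hG hH hab.symm hadj).symm
  · rintro (hadj | hadj)
    · exact h.symm.adj_or_adj hH hG hab hadj
    · exact (h.symm.adj_or_adj hH hG hab.symm hadj).symm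

/-- Markov equivalent DAGs have the same v-structures. -/
lemma MarkovEquivalent.isVStructure {G H : Digraph V} (h : MarkovEquivalent G H)
    (hG : IsDAG G) (hH : IsDAG H) {u v w : V} (hv : IsVStructure G u v w) :
    IsVStructure H u v w := by
  obtain ⟨huv, hwv, huw, hn⟩ := hv
  have huv' : u ≠ v := by rintro rfl; exact hG u (.single huv)
  have hwv' : w ≠ v := by rintro rfl; exact hG w (.single hwv)
  have hnH : ¬ (skeleton H).Adj u w := h.skeleton_eq hG hH ▸ hn
  have hT : ({u, v, w} : Set V).Nontrivial := ⟨u, by simp, v, by simp, huv'⟩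
  obtain ⟨c, hc, hp⟩ := (h.exists_common_child_iff hG hH hT).1 ⟨v, by simp, by
    rintro t (rfl | rfl | rfl) ht
    · exact huv
    · exact absurd rfl ht
    · exact hwv⟩
  rw [skeleton_adj] at hnH
  -- The common child must be `v`, since `u` and `w` are non-adjacent.
  rcases hc with rfl | rfl | rfl
  · exact absurd ⟨huw, .inr (hp w (by simp) huw.symm)⟩ hnH
  · exact ⟨hp u (by simp) huv', hp w (by simp) hwv', huw, by rwa [skeleton_adj]⟩
  · exact absurd ⟨huw, .inl (hp u (by simp) huw)⟩ hnH

lemma MarkovEquivalent.isMoralDAG {G H : Digraph V} (h : MarkovEquivalent G H)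
    (hG : IsMoralDAG G) (hH : IsDAG H) : IsMoralDAG H :=
  ⟨hH, fun u v w hv => hG.2 u v w (h.symm.isVStructure hH hG.1 hv)⟩

end Parity

/-! ### Descendants -/

section Descendants

variable {V : Type*}

/-- There is a directed path with `n` arcs from `u` to `w`. -/
def HasPathOfLength (G : Digraph V) (u : V) : ℕ → V → Prop
  | 0, w => w = u
  | n + 1, w => ∃ p, HasPathOfLength G u n p ∧ G.Adj p w

/-- The shortest directed path from `u` to `w` has `n` arcs. -/
def HasDist (G : Digraph V) (u : V) (n : ℕ) (w : V) : Prop :=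
  HasPathOfLength G u n w ∧ ∀ m < n, ¬ HasPathOfLength G u m w

lemma HasDist.exists_pred {G : Digraph V} {u w : V} {n : ℕ} (h : HasDist G u (n + 1) w) :
    ∃ p, HasDist G u n p ∧ G.Adj p w := by
  obtain ⟨⟨p, hp, hpw⟩, hmin⟩ := h
  exact ⟨p, ⟨hp, fun m hm hpm => hmin (m + 1) (by omega) ⟨p, hpm, hpw⟩⟩, hpw⟩

lemma exists_hasDist_of_transGen {G : Digraph V} {u w : V} (h : Relation.TransGen G.Adj u w) :
    ∃ n, HasDist G u n w := by
  classical
  have : ∃ n, HasPathOfLength G u n w := by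
    induction h with
    | single h => exact ⟨1, u, rfl, h⟩
    | tail _ h ih => exact ih.elim fun n hn => ⟨n + 1, _, hn, h⟩
  exact ⟨Nat.find this, Nat.find_spec this, fun m hm => Nat.find_min this hm⟩

/-- Arcs on shortest directed paths from `u` are preserved if the arcs out of `u` are and no
v-structures are created. -/
lemma adj_of_hasDist {G H : Digraph V} (hG : IsDAG G) (hs : skeleton G = skeleton H)
    (hH : ∀ u v w, ¬ IsVStructure H u v w) {u : V} (hu : ∀ w, G.Adj u w → H.Adj u w) :
    ∀ (n : ℕ) (p w : V), HasDist G u n p → HasDist G u (n + 1) w → G.Adj p w → H.Adj p w := by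
  intro n
  induction n with
  | zero =>
    rintro p w ⟨rfl, -⟩ - hpw
    exact hu w hpw
  | succ n ih =>
    intro p w hp hw hpw
    obtain ⟨o, ho, hop⟩ := hp.exists_pred
    have hopH := ih o p ho hp hop
    have hpne : p ≠ w := by rintro rfl; exact hG p (.single hpw)
    have hadj : (skeleton H).Adj p w := hs ▸ skeleton_adj.2 ⟨hpne, .inl hpw⟩
    rcases (skeleton_adj.1 hadj).2 with h | h
    · exact h
    -- A reversed arc would give the v-structure `o → p ← w` in `H`: in `G`, `o → w` would shorten
    -- the path to `w`, and `w → o` would close a cycle.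
    · refine absurd ⟨hopH, h, ?_, ?_⟩ (hH o p w)
      · rintro rfl
        exact hG o (.tail (.single hop) hpw)
      · rw [← hs, skeleton_adj]
        rintro ⟨-, h | h⟩
        · exact hw.2 (n + 1) (by omega) ⟨o, ho.1, h⟩
        · exact hG o (.tail (.tail (.single hop) hpw) h)

lemma des_subset_des {G H : Digraph V} (hG : IsDAG G) (hs : skeleton G = skeleton H)
    (hH : ∀ u v w, ¬ IsVStructure H u v w) {u : V} (hu : ∀ w, G.Adj u w → H.Adj u w) :
    des G u ⊆ des H u := by
  have key : ∀ n w, HasDist G u (n + 1) w → w ∈ des H u := by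
    intro n
    induction n with
    | zero =>
      intro w hw
      obtain ⟨p, hp, hpw⟩ := hw.exists_pred
      obtain rfl : p = u := hp.1
      exact .single (hu w hpw)
    | succ n ih =>
      intro w hw
      obtain ⟨p, hp, hpw⟩ := hw.exists_pred
      exact .tail (ih p hp) (adj_of_hasDist hG hs hH hu _ p w hp hw hpw)
  intro w hw
  obtain ⟨n, hn⟩ := exists_hasDist_of_transGen hw
  cases n with
  | zero =>
    obtain rfl : w = u := hn.1
    exact absurd hw (hG w)
  | succ n => exact key n w hn

lemma mem_desClosed {G : Digraph V} {v w : V} :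
    w ∈ desClosed G v ↔ Relation.ReflTransGen G.Adj v w := by
  rw [Relation.reflTransGen_iff_eq_or_transGen]
  rfl

/-- Two ancestors of a vertex of a moral DAG have a common ancestor. -/
lemma exists_common_ancestor_of_reflTransGen [Finite V] {G : Digraph V} (hG : IsMoralDAG G)
    {p q w : V} (hp : Relation.ReflTransGen G.Adj p w) (hq : Relation.ReflTransGen G.Adj q w) :
    ∃ r, Relation.ReflTransGen G.Adj r p ∧ Relation.ReflTransGen G.Adj r q := by
  have : Std.Irrefl (Relation.TransGen G.Adj) := ⟨hG.1⟩
  have hwf : WellFounded (Relation.TransGen G.Adj) :=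
    Finite.wellFounded_of_trans_of_irrefl _
  -- The last arcs into `w` come from equal or adjacent parents by morality; the later parent
  -- replaces `w`.
  induction w using hwf.induction generalizing p q with
  | _ w ih =>
    rcases hp.cases_tail with rfl | ⟨p', hp', hpw⟩
    · exact ⟨q, hq, .refl⟩
    rcases hq.cases_tail with rfl | ⟨q', hq', hqw⟩
    · exact ⟨p, .refl, hp⟩
    by_cases hne : p' = q'
    · subst hne
      exact ih p' (.single hpw) hp' hq'
    · have hadj : (skeleton G).Adj p' q' := by
        by_contra hn
        exact hG.2 p' w q' ⟨hpw, hqw, hne, hn⟩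
      rcases (skeleton_adj.1 hadj).2 with h | h
      · exact ih q' (.single hqw) (hp'.tail h) hq'
      · exact ih p' (.single hpw) hp' (hq'.tail h)

/-- Any two vertices of a connected moral DAG have a common ancestor. -/
lemma exists_common_ancestor [Finite V] {G : Digraph V} (hG : IsMoralDAG G)
    (hconn : (skeleton G).Connected) (a b : V) :
    ∃ r, Relation.ReflTransGen G.Adj r a ∧ Relation.ReflTransGen G.Adj r b := by
  have h := (SimpleGraph.reachable_iff_reflTransGen a b).1 (hconn a b)
  induction h with
  | refl => exact ⟨a, .refl, .refl⟩
  | tail _ hadj ih =>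
    obtain ⟨r, hra, hrb⟩ := ih
    rcases (skeleton_adj.1 hadj).2 with h | h
    · exact ⟨r, hra, hrb.tail h⟩
    · obtain ⟨s, hsr, hs⟩ := exists_common_ancestor_of_reflTransGen hG hrb (.single h)
      exact ⟨s, hsr.trans hra, hs⟩

lemma adj_of_isClique_of_mem_des {G : Digraph V} (hG : IsDAG G) {K : Set V}
    (hK : (skeleton G).IsClique K) {a b : V} (ha : a ∈ K) (hb : b ∈ K) (h : b ∈ des G a) :
    G.Adj a b := by
  have hne : a ≠ b := by rintro rfl; exact hG a h
  rcases (skeleton_adj.1 (hK ha hb hne)).2 with h' | h'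
  · exact h'
  · exact absurd (h.tail h') (hG a)

lemma mem_des_or_mem_des {G : Digraph V} {K : Set V}
    (hK : (skeleton G).IsClique K) {a b : V} (ha : a ∈ K) (hb : b ∈ K) (hne : a ≠ b) :
    b ∈ des G a ∨ a ∈ des G b :=
  (skeleton_adj.1 (hK ha hb hne)).2.imp .single .single

end Descendants

/-! ### Separators and components -/

section Components

variable {V : Type*}

lemma mem_part_of_adj {S : SimpleGraph V} {A B K : Set V}
    (hcov : A ∪ B ∪ K = Set.univ) (hno : ∀ a ∈ A, ∀ b ∈ B, ¬ S.Adj a b)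
    {a b : V} (hab : S.Adj a b) (ha : a ∈ A) (hb : b ∉ K) : b ∈ A := by
  have : b ∈ A ∪ B ∪ K := hcov ▸ Set.mem_univ b
  rcases this with (h | h) | h
  · exact h
  · exact absurd hab (hno a ha b h)
  · exact absurd h hb

/-- A set off the separator that is connected, in the sense that each subset of the complement of
`K` closed under adjacency within the set contains all or nothing of it, is small. -/
lemma IsSeparator.ncard_le [Finite V] {S : SimpleGraph V} {K C : Set V} {α : ℝ}
    (hK : IsSeparator α S K) (hne : C.Nonempty) (hCK : Disjoint C K)
    (hC : ∀ A : Set V, (∀ a b, S.Adj a b → a ∈ C → b ∈ C → a ∈ A → b ∈ A) →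
      (C ∩ A).Nonempty → C ⊆ A) :
    (C.ncard : ℝ) ≤ α * Nat.card V := by
  obtain ⟨A, B, hcov, -, -, -, hno, hA, hB⟩ := hK
  obtain ⟨c, hc⟩ := hne
  have hoff : ∀ {b}, b ∈ C → b ∉ K := fun hb hbK => Set.disjoint_left.1 hCK hb hbK
  have hle : ∀ {D : Set V}, C ⊆ D → (C.ncard : ℝ) ≤ D.ncard := fun h => by
    exact_mod_cast Set.ncard_le_ncard h
  have : c ∈ A ∪ B ∪ K := hcov ▸ Set.mem_univ c
  rcases this with (h | h) | h
  · exact (hle (hC A (fun a b hab _ hb ha =>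
      mem_part_of_adj hcov hno hab ha (hoff hb)) ⟨c, hc, h⟩)).trans hA
  · refine (hle (hC B (fun a b hab _ hb ha =>
      mem_part_of_adj (Set.union_comm A B ▸ hcov) (fun x hx y hy hxy => hno y hy x hx hxy.symm)
        hab ha (hoff hb)) ⟨c, hc, h⟩)).trans hB
  · exact absurd h (hoff hc)

/-- If `K` were empty, the whole connected graph would lie in one part, giving `|V| ≤ α |V|`. -/
lemma IsCliqueSeparator.nonempty [Finite V] [Nonempty V] {S : SimpleGraph V} {K : Set V} {α : ℝ}
    (hK : IsCliqueSeparator α S K) (hα : α < 1) (hconn : S.Connected) : K.Nonempty := by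
  by_contra hne
  rw [Set.not_nonempty_iff_eq_empty] at hne
  have h := hK.1.ncard_le (C := Set.univ) Set.univ_nonempty (by simp [hne]) (by
    rintro A hA ⟨a, -, ha⟩ b -
    have h := (SimpleGraph.reachable_iff_reflTransGen a b).1 (hconn a b)
    induction h with
    | refl => exact ha
    | tail _ hadj ih => exact hA _ _ hadj trivial trivial ih)
  rw [Set.ncard_univ] at h
  have : (0 : ℝ) < Nat.card V := by exact_mod_cast Nat.card_pos
  nlinarith

/-- The non-descendants of a vertex whose descendants cover the separator are few. -/
lemma ncard_compl_desClosed_le [Finite V] {G : Digraph V} (hG : IsMoralDAG G)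
    (hconn : (skeleton G).Connected) {K : Set V} {α : ℝ} (hα : 0 ≤ α)
    (hK : IsSeparator α (skeleton G) K) {k : V} (hk : K ⊆ desClosed G k) :
    ((desClosed G k)ᶜ.ncard : ℝ) ≤ α * Nat.card V := by
  rcases (desClosed G k)ᶜ.eq_empty_or_nonempty with he | hne
  · rw [he, Set.ncard_empty, Nat.cast_zero]
    positivity
  refine hK.ncard_le hne (Set.disjoint_left.2 fun a ha haK => ha (hk haK)) ?_
  rintro A hA ⟨a, ha, haA⟩ b hb
  -- Ancestors of non-descendants are non-descendants, so the paths from a common ancestor of `a`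
  -- and `b` stay in the set.
  have hanc : ∀ {r c}, Relation.ReflTransGen G.Adj r c → c ∈ (desClosed G k)ᶜ →
      r ∈ (desClosed G k)ᶜ ∧ (r ∈ A ↔ c ∈ A) := by
    intro r c hrc hc
    induction hrc using Relation.ReflTransGen.head_induction_on with
    | refl => exact ⟨hc, Iff.rfl⟩
    | @head x y hxy _ ih =>
      have hx : x ∈ (desClosed G k)ᶜ := fun hx =>
        ih.1 (mem_desClosed.2 ((mem_desClosed.1 hx).tail hxy))
      have hadj : (skeleton G).Adj x y :=
        skeleton_adj.2 ⟨by rintro rfl; exact hG.1 x (.single hxy), .inl hxy⟩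
      exact ⟨hx, Iff.trans ⟨hA x y hadj hx ih.1, hA y x hadj.symm ih.1 hx⟩ ih.2⟩
  obtain ⟨r, hra, hrb⟩ := exists_common_ancestor hG hconn a b
  exact (hanc hrb hb).2.1 ((hanc hra ha).2.2 haA)

/-- Puts connectivity of a component in the form that `IsSeparator.ncard_le` requires. -/
lemma supp_subset_of_adj {U : SimpleGraph V} (C : U.ConnectedComponent) {Q : Set V}
    (hQ : ∀ a b, U.Adj a b → a ∈ C.supp → b ∈ C.supp → a ∈ Q → b ∈ Q)
    (hne : (C.supp ∩ Q).Nonempty) : C.supp ⊆ Q := by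
  obtain ⟨a, ha, haQ⟩ := hne
  intro b hb
  have h := (SimpleGraph.reachable_iff_reflTransGen a b).1
    (SimpleGraph.ConnectedComponent.exact (ha.trans hb.symm))
  clear hb
  have : b ∈ C.supp ∧ b ∈ Q := by
    induction h with
    | refl => exact ⟨ha, haQ⟩
    | tail _ hadj ih =>
      have hc := C.mem_supp_of_adj_mem_supp ih.1 hadj
      exact ⟨hc, hQ _ _ hadj ih.1 hc ih.2⟩
  exact this.2

variable [Fintype V]

lemma undirected_le_skeleton {G : Digraph V} (hG : IsDAG G) {𝓘 : Set (Set V)} {a b : V}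
    (h : (essentialGraph G 𝓘).undirected.Adj a b) : (skeleton G).Adj a b := by
  obtain ⟨H, hH, -, -, hab, -⟩ := h
  rw [hH.2.1.skeleton_eq hG hH.1, skeleton_adj]
  exact ⟨by rintro rfl; exact hH.1 a (.single hab), .inl hab⟩

lemma adj_iff_of_mem_interventionalClass {G H : Digraph V} {𝓘 : Set (Set V)} {u : V}
    (hG : IsDAG G) (hu : {u} ∈ 𝓘) (hH : H ∈ interventionalClass G 𝓘) (w : V) :
    H.Adj u w ↔ G.Adj u w := by
  by_cases hw : w = u
  · subst hw
    exact iff_of_false (fun h => hH.1 w (.single h)) (fun h => hG w (.single h))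
  · exact hH.2.2 {u} hu u w (.inl ⟨rfl, hw⟩)

/-- The descendants of an intervened vertex are the same in the whole class. -/
lemma des_eq_of_mem_interventionalClass {G H : Digraph V} {𝓘 : Set (Set V)} {u : V}
    (hG : IsMoralDAG G) (hu : {u} ∈ 𝓘) (hH : H ∈ interventionalClass G 𝓘) :
    des H u = des G u := by
  have hs := hH.2.1.skeleton_eq hG.1 hH.1
  have hadj := adj_iff_of_mem_interventionalClass hG.1 hu hH
  -- `G` and `H` play symmetric roles, since `H` is moral too.
  exact (des_subset_des hH.1 hs.symm hG.2 fun w => (hadj w).1).antisymm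
    (des_subset_des hG.1 hs (hH.2.1.isMoralDAG hG hH.1).2 fun w => (hadj w).2)

lemma mem_des_of_undirected_adj {G : Digraph V} {𝓘 : Set (Set V)} {u a b : V}
    (hG : IsMoralDAG G) (hu : {u} ∈ 𝓘) (h : (essentialGraph G 𝓘).undirected.Adj a b)
    (ha : a ∈ des G u) : b ∈ des G u := by
  obtain ⟨H, hH, -, -, hab, -⟩ := h
  rw [← des_eq_of_mem_interventionalClass hG hu hH] at ha ⊢
  exact ha.tail hab

/-- All members share the arcs out of `u`, so opposite orientations would put a 2-cycle in one
member. -/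
lemma not_undirected_adj {G : Digraph V} {𝓘 : Set (Set V)} {u b : V}
    (hG : IsMoralDAG G) (hu : {u} ∈ 𝓘) : ¬ (essentialGraph G 𝓘).undirected.Adj u b := by
  rintro ⟨H₁, h₁, H₂, h₂, hab, hba⟩
  rw [adj_iff_of_mem_interventionalClass hG.1 hu h₁,
    ← adj_iff_of_mem_interventionalClass hG.1 hu h₂] at hab
  exact h₂.1 u (.tail (.single hab) hba)

/-- A chain component lies among the non-descendants of an intervened vertex, consists of that
vertex, or lies among its descendants. -/
lemma supp_trichotomy {G : Digraph V} {𝓘 : Set (Set V)} {u : V} (hG : IsMoralDAG G)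
    (hu : {u} ∈ 𝓘) (C : (essentialGraph G 𝓘).undirected.ConnectedComponent) :
    C.supp ⊆ (desClosed G u)ᶜ ∨ C.supp ⊆ {u} ∨ C.supp ⊆ des G u := by
  by_cases h1 : (C.supp ∩ {u}).Nonempty
  · refine .inr (.inl (supp_subset_of_adj C ?_ h1))
    rintro a b hab - - rfl
    exact absurd hab (not_undirected_adj hG hu)
  by_cases h2 : (C.supp ∩ des G u).Nonempty
  · exact .inr (.inr (supp_subset_of_adj C
      (fun a b hab _ _ => mem_des_of_undirected_adj hG hu hab) h2))
  · left
    rintro a ha (rfl | h)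
    · exact h1 ⟨a, ha, rfl⟩
    · exact h2 ⟨a, ha, h⟩

lemma ncard_supp_le_of_disjoint {G : Digraph V} {𝓘 : Set (Set V)} {K : Set V} {α : ℝ}
    (hG : IsDAG G) (hK : IsSeparator α (skeleton G) K)
    (C : (essentialGraph G 𝓘).undirected.ConnectedComponent) (hC : Disjoint C.supp K) :
    (C.supp.ncard : ℝ) ≤ α * Nat.card V :=
  hK.ncard_le C.nonempty_supp hC fun _ hA hne =>
    supp_subset_of_adj C (fun a b hab => hA a b (undirected_le_skeleton hG hab)) hne

end Components

end CausalGraph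

open CausalGraph in
theorem lemma3 {V : Type*} [Fintype V] (hV : 2 ≤ Fintype.card V) (G : Digraph V)
    (hG : CausalGraph.IsMoralDAG G) (hconn : (CausalGraph.skeleton G).Connected)
    (K : Set V) (hK : CausalGraph.IsCliqueSeparator (1 / 2) (CausalGraph.skeleton G) K) :
    (∃ u ∈ K, CausalGraph.SatisfiesConstraints G K u) ∧
    ∀ u ∈ K, CausalGraph.SatisfiesConstraints G K u →
      (CausalGraph.IsSinkOf G K u ∨ ∃ x, CausalGraph.IsNext G K u x) ∧
      (CausalGraph.IsSinkOf G K u → CausalGraph.IsMeekSeparator (1 / 2) G {{u}}) ∧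
      (∀ x, CausalGraph.IsNext G K u x →
        CausalGraph.IsMeekSeparator (1 / 2) G {{u}, {x}}) := by
  have : Nonempty V := hconn.nonempty
  have hirr : Std.Irrefl (Relation.TransGen G.Adj) := ⟨hG.1⟩
  have hirr' : Std.Irrefl (Function.swap (Relation.TransGen G.Adj)) := ⟨hG.1⟩
  have htr' : IsTrans V (Function.swap (Relation.TransGen G.Adj)) := ⟨fun _ _ _ h h' => h'.trans h⟩
  have hwf : WellFounded (Relation.TransGen G.Adj) := Finite.wellFounded_of_trans_of_irrefl _
  have hwf' : WellFounded (Function.swap (Relation.TransGen G.Adj)) :=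
    Finite.wellFounded_of_trans_of_irrefl _
  have hhalf : (1 / 2 : ℝ) * Nat.card V = (Nat.card V : ℝ) / 2 := by ring
  have hV' : (2 : ℝ) ≤ Nat.card V := by
    rw [Nat.card_eq_fintype_card]
    exact_mod_cast hV
  have hsmall : ∀ {S T : Set V}, S ⊆ T → (T.ncard : ℝ) ≤ (Nat.card V : ℝ) / 2 →
      (S.ncard : ℝ) ≤ 1 / 2 * Nat.card V := fun {S T} h hT => by
    rw [hhalf]
    exact le_trans (by exact_mod_cast Set.ncard_le_ncard h) hT
  have hsingle : ∀ v : V, (({v} : Set V).ncard : ℝ) ≤ (Nat.card V : ℝ) / 2 := fun v => by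
    rw [Set.ncard_singleton]
    push_cast
    linarith
  refine ⟨?_, fun u huK hu => ⟨?_, ?_, ?_⟩⟩
  · obtain ⟨k, hkK, hk⟩ := hwf.has_min K (hK.nonempty (by norm_num) hconn)
    have hkcov : K ⊆ desClosed G k := by
      intro y hy
      by_cases hne : y = k
      · exact .inl hne
      · exact .inr ((mem_des_or_mem_des hK.2 hkK hy (Ne.symm hne)).resolve_right (hk y hy))
    have hkle := ncard_compl_desClosed_le hG hconn (by norm_num) hK.1 hkcov
    rw [hhalf] at hkle
    -- Minimality for the swapped relation picks a last vertex of `K` with few non-descendants.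
    obtain ⟨u, ⟨huK, hule⟩, hu⟩ := hwf'.has_min
      {v | v ∈ K ∧ ((desClosed G v)ᶜ.ncard : ℝ) ≤ (Nat.card V : ℝ) / 2} ⟨k, hkK, hkle⟩
    exact ⟨u, huK, hule, fun v hv => lt_of_not_ge fun hle => hu v ⟨hv.2, hle⟩ hv.1⟩
  · rcases (des G u ∩ K).eq_empty_or_nonempty with he | hne
    · exact .inl ⟨huK, fun w hw h => he.subset ⟨.single h, hw⟩⟩
    -- The earliest vertex of `K` below `u` is the next one, as the clique is totally ordered.
    · obtain ⟨x, hx, hmin⟩ := hwf.has_min _ hne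
      refine .inr ⟨x, hx, Set.eq_empty_iff_forall_notMem.2 ?_⟩
      rintro y ⟨⟨hyx, hyu⟩, hyK⟩
      rcases mem_des_or_mem_des hK.2 hx.2 hyK fun h => hyx (.inl h.symm) with h | h
      · exact hyx (.inr h)
      · exact hmin y ⟨hyu, hyK⟩ h
  · intro hsink C
    rcases supp_trichotomy hG (Set.mem_singleton _) C with h | h | h
    · exact hsmall h hu.1
    · exact hsmall h (hsingle u)
    · refine ncard_supp_le_of_disjoint hG.1 hK.1 C (Set.disjoint_left.2 fun a ha haK => ?_)
      exact hsink.2 a haK (adj_of_isClique_of_mem_des hG.1 hK.2 huK haK (h ha))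
  · intro x hx C
    rcases supp_trichotomy hG (Set.mem_insert _ _) C with h | h | h
    · exact hsmall h hu.1
    · exact hsmall h (hsingle u)
    · rcases supp_trichotomy hG (Set.mem_insert_of_mem _ (Set.mem_singleton {x})) C with
        h' | h' | h'
      · refine ncard_supp_le_of_disjoint hG.1 hK.1 C (Set.disjoint_left.2 fun a ha haK => ?_)
        exact hx.2.subset ⟨⟨h' ha, h ha⟩, haK⟩
      · exact hsmall h' (hsingle x)
      · refine hsmall (h'.trans (Set.subset_insert x _)) ?_
        have hlt := hu.2 x hx.1
        have hadd : ((desClosed G x).ncard : ℝ) + ((desClosed G x)ᶜ.ncard : ℝ) = Nat.card V := by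
          exact_mod_cast Set.ncard_add_ncard_compl (desClosed G x)
        change ((desClosed G x).ncard : ℝ) ≤ _
        linarith
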